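/- For an integer $n\ge 4$, let $D_n$ be the Dynkin graph on the vertices $1,2,\ldots,n$, that is, the tree with edges $\{1,3\}$ and $\{i,i+1\}$ for $2\le i\le n-1$. Let $A$ be its adjacency matrix, let $e$ be the all-one vector, and let $W(D_n)=[e,Ae,\ldots,A^{n-1}e]$ be its walk matrix, the $n\times n$ integer matrix whose columns are $e,Ae,\ldots,A^{n-1}e$. The Smith normal form of an $n\times n$ integer matrix $M$ is the unique diagonal matrix $\mathrm{diag}[d_1,\ldots,d_n]$ with integers $d_i\ge 0$ and $d_i\mid d_{i+1}$ for $1\le i\le n-1$ (where $0\mid 0$) that equals $PMQ$ for some integer matrices $P,Q$ with determinant $\pm1$. **Theorem.** If $4\mid n$, then the Smith normal form of $W(D_n)$ is $$\mathrm{diag}[\underbrace{1,1,\ldots,1}_{\frac n2-1},\underbrace{2,2,\ldots,2}_{\frac n2-1},0,0].$$ -/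

import Mathlib

/-- The Dynkin graph `D_n` on the vertices `0, 1, …, n - 1`: the path `1 — 2 — ⋯ — (n - 1)`
together with the vertex `0`, which is joined to the vertex `2` only. So `0` and `1` are the two
leaves at the branch vertex `2`, and the remaining vertices form the long arm. -/
def dynkinD (n : ℕ) : SimpleGraph (Fin n) :=
  SimpleGraph.fromRel fun i j : Fin n =>
    (i.val = 0 ∧ j.val = 2) ∨ (1 ≤ i.val ∧ j.val = i.val + 1)

instance dynkinD.decidableRelAdj (n : ℕ) : DecidableRel (dynkinD n).Adj := fun i j =>
  decidable_of_iff _ (SimpleGraph.fromRel_adj (fun i j : Fin n =>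
    (i.val = 0 ∧ j.val = 2) ∨ (1 ≤ i.val ∧ j.val = i.val + 1)) i j).symm

/-- The walk matrix `[e, A e, …, A ^ (n - 1) e]` of a graph with adjacency matrix `A`, where `e` is
the all-one vector: its `k`-th column is `A ^ k e`, for `k = 0, …, n - 1`. -/
def walkMatrix {n : ℕ} (G : SimpleGraph (Fin n)) [DecidableRel G.Adj] :
    Matrix (Fin n) (Fin n) ℤ :=
  Matrix.of fun i k => Matrix.mulVec (G.adjMatrix ℤ ^ (k : ℕ)) (fun _ => 1) i

/-- `S` is the Smith normal form of the integral matrix `M`: it is diagonal, its diagonal entries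
are nonnegative and each of them divides the next, and `S = P M Q` with `P` and `Q` unimodular. -/
def IsSmithNormalForm {n : ℕ} (M S : Matrix (Fin n) (Fin n) ℤ) : Prop :=
  S.IsDiag ∧
  (∀ i, 0 ≤ S i i) ∧
  (∀ i j : Fin n, i.val + 1 = j.val → S i i ∣ S j j) ∧
  ∃ P Q : Matrix (Fin n) (Fin n) ℤ, IsUnit P.det ∧ IsUnit Q.det ∧ P * M * Q = S

/-! The walk matrix sends the coefficient vector of `p` to `p(A) e` (`walkMatrix_mulVec_coeffVec`),
so it suffices to find bases of the integral polynomials of degree less than `n` and of `ℤ ^ n` in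
which `p ↦ p(A) e` is diagonal. Write `n = 2 h + 2` with `h` odd. The vectors `C k (A) e` are
explicit (`aeval_chebC_mulVec_one`), and for `1 ≤ k ≤ h` those of index `k` and `2 h + 1 - k` differ
by twice the indicator of a middle piece of the long arm. Both `C (2 h + 1)` and its quotient by `X`
annihilate `e`, the quotient because `h` is odd. Hence `h` images are kept, `h` are halved and two
vanish. That both families are bases over `ℤ` is `isUnit_det_sourcePoly` and `isUnit_det_targetVec`.
-/

open Polynomial

/-! ### Chebyshev polynomials. -/

/-- The rescaled Chebyshev polynomial `C k`, with `C k (t + t⁻¹) = t ^ k + t⁻¹ ^ k`, indexed by the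
natural numbers. -/
noncomputable abbrev chebC (k : ℕ) : ℤ[X] := Chebyshev.C ℤ (k : ℤ)

theorem chebC_zero : chebC 0 = 2 := by simp [chebC]

theorem chebC_one : chebC 1 = X := by simp [chebC]

theorem chebC_add_two (k : ℕ) : chebC (k + 2) = X * chebC (k + 1) - chebC k := by
  simp [chebC]

theorem natDegree_chebC_le (k : ℕ) : (chebC k).natDegree ≤ k := by
  induction k using Nat.twoStepInduction with
  | zero => simp [chebC_zero]
  | one => simp [chebC_one]
  | more k h0 h1 =>
    rw [chebC_add_two]
    refine (natDegree_sub_le _ _).trans (max_le ?_ (by omega))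
    refine natDegree_mul_le.trans ?_
    have := natDegree_X_le (R := ℤ)
    omega

/-- The alternating sum `C (2 r) - C (2 r - 2) + ⋯ ± C 2 ∓ 1`; this is `C (2 r + 1) / X`. -/
noncomputable def altChebC : ℕ → ℤ[X]
  | 0 => 1
  | r + 1 => chebC (2 * r + 2) - altChebC r

theorem X_mul_altChebC (r : ℕ) : X * altChebC r = chebC (2 * r + 1) := by
  induction r with
  | zero => simp [altChebC, chebC_one]
  | succ r ih =>
    rw [altChebC, mul_sub, ih]
    exact (chebC_add_two (2 * r + 1)).symm

theorem natDegree_altChebC_le (r : ℕ) : (altChebC r).natDegree ≤ 2 * r := by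
  induction r with
  | zero => simp [altChebC]
  | succ r ih =>
    have := natDegree_chebC_le (2 * r + 2)
    exact (natDegree_sub_le _ _).trans (max_le (by omega) (by omega))

/-! ### Unimodularity, and the walk matrix as evaluation of polynomials. -/

/-- A family of `n` integral vectors that generates `ℤ ^ n` forms a unimodular matrix. -/
theorem isUnit_det_of_span {n : ℕ} (b : Fin n → Fin n → ℤ)
    (hb : ∀ i, Pi.single i 1 ∈ Submodule.span ℤ (Set.range b)) :
    IsUnit (Matrix.of fun i k => b k i).det := by
  rw [← Matrix.isUnit_iff_isUnit_det, ← Matrix.mulVec_surjective_iff_isUnit]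
  have hr : LinearMap.range (Matrix.of fun i k => b k i).mulVecLin = ⊤ := by
    rw [Matrix.range_mulVecLin, eq_top_iff, ← (Pi.basisFun ℤ (Fin n)).span_eq, Submodule.span_le]
    rintro _ ⟨i, rfl⟩
    rw [Pi.basisFun_apply]
    exact hb i
  exact LinearMap.range_eq_top.1 hr

/-- The coefficient vector of a polynomial, truncated to length `n`. -/
noncomputable def coeffVec (n : ℕ) : ℤ[X] →ₗ[ℤ] (Fin n → ℤ) :=
  LinearMap.pi fun i => lcoeff ℤ i

theorem coeffVec_apply (n : ℕ) (p : ℤ[X]) (i : Fin n) : coeffVec n p i = p.coeff i := rfl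

theorem coeffVec_X_pow (n : ℕ) (i : Fin n) : coeffVec n (X ^ (i : ℕ)) = Pi.single i 1 := by
  ext j
  simp [coeffVec_apply, coeff_X_pow, Pi.single_apply, Fin.ext_iff]

theorem walkMatrix_mulVec_coeffVec {n : ℕ} (G : SimpleGraph (Fin n)) [DecidableRel G.Adj]
    {p : ℤ[X]} (hp : p.natDegree < n) :
    Matrix.mulVec (walkMatrix G) (coeffVec n p) =
      Matrix.mulVec (aeval (G.adjMatrix ℤ) p) (fun _ => 1) := by
  rw [aeval_eq_sum_range' hp, Finset.sum_range (fun i => p.coeff i • G.adjMatrix ℤ ^ i),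
    Matrix.sum_mulVec]
  ext i
  simp only [Matrix.mulVec, dotProduct, walkMatrix, Matrix.of_apply, coeffVec_apply,
    Finset.sum_apply, Matrix.smul_apply, mul_one, smul_eq_mul]
  exact Finset.sum_congr rfl fun k _ => by rw [mul_comm, Finset.mul_sum]

theorem sum_fin_ite_val_eq {n : ℕ} (g : ℕ → ℤ) (a : ℕ) :
    ∑ j : Fin n, (if j.val = a then g j.val else 0) = if a < n then g a else 0 := by
  rw [Fin.sum_univ_eq_sum_range (fun j => if j = a then g j else 0)]
  simp [Finset.sum_ite_eq']

/-! ### The adjacency matrix of `D_n` and its kernel. -/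

/-- The action of the adjacency matrix of `D_n` on a vector. -/
theorem dynkinD_adjMatrix_mulVec {n : ℕ} (hn : 4 ≤ n) (g : ℕ → ℤ) (i : Fin n) :
    Matrix.mulVec ((dynkinD n).adjMatrix ℤ) (fun j => g j.val) i =
      if i.val ≤ 1 then g 2 else
        (if i.val = 2 then g 0 else 0) + g (i.val - 1) +
          if i.val + 1 < n then g (i.val + 1) else 0 := by
  have hi := i.isLt
  have key : ∀ j : Fin n, (dynkinD n).adjMatrix ℤ i j * g j.val =
      (if 1 ≤ i.val then (if j.val = i.val + 1 then g j.val else 0) else 0) +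
      (if 2 ≤ i.val then (if j.val = i.val - 1 then g j.val else 0) else 0) +
      (if i.val = 0 then (if j.val = 2 then g j.val else 0) else 0) +
      (if i.val = 2 then (if j.val = 0 then g j.val else 0) else 0) := by
    intro j
    have hadj : (dynkinD n).Adj i j ↔ _ := SimpleGraph.fromRel_adj _ i j
    simp only [SimpleGraph.adjMatrix_apply, hadj, ne_eq, Fin.ext_iff]
    split_ifs <;> omega
  simp only [Matrix.mulVec, dotProduct]
  rw [Finset.sum_congr rfl fun j _ => key j]
  simp only [Finset.sum_add_distrib, Finset.sum_ite_irrel, Finset.sum_const_zero,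
    sum_fin_ite_val_eq]
  by_cases h0 : i.val = 0
  · simp [h0]; omega
  by_cases h1 : i.val = 1
  · simp [h1]; omega
  have : i.val - 1 < n := by omega
  split_ifs <;> omega

/-- A vector in the kernel of the adjacency matrix of `D_n` vanishes if it takes equal values on
the two short leaves and vanishes on the long one. -/
theorem eq_zero_of_dynkinD_adjMatrix_mulVec_eq_zero {n : ℕ} (hn : 4 ≤ n) (g : ℕ → ℤ)
    (hg : Matrix.mulVec ((dynkinD n).adjMatrix ℤ) (fun j => g j.val) = 0)
    (h01 : g 0 = g 1) (hlast : g (n - 1) = 0) : ∀ i < n, g i = 0 := by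
  have row : ∀ i (hi : i < n), (if i ≤ 1 then g 2 else
        (if i = 2 then g 0 else 0) + g (i - 1) + if i + 1 < n then g (i + 1) else 0) = 0 := by
    intro i hi
    have := congrFun hg ⟨i, hi⟩
    rwa [dynkinD_adjMatrix_mulVec hn] at this
  -- Along the long arm the rows read `g (i - 1) = -g (i + 1)`; the last entry starts one parity
  -- class, the last row the other.
  have down : ∀ k, k + 3 ≤ n → g (n - 1 - k) = 0 := by
    intro k
    induction k using Nat.strong_induction_on with
    | _ k ih =>
      intro hk
      match k with
      | 0 => simpa using hlast
      | 1 =>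
        have := row (n - 1) (by omega)
        rw [if_neg (by omega), if_neg (by omega), if_neg (by omega)] at this
        simpa using this
      | k + 2 =>
        have := row (n - 1 - (k + 1)) (by omega)
        rw [if_neg (by omega), if_neg (by omega), if_pos (by omega),
          show n - 1 - (k + 1) + 1 = n - 1 - k by omega, ih k (by omega) (by omega)] at this
        rw [show n - 1 - (k + 2) = n - 1 - (k + 1) - 1 by omega]
        simpa using this
  have h3 : g 3 = 0 := by
    have := down (n - 4) (by omega)
    rwa [show n - 1 - (n - 4) = 3 by omega] at this
  have h2 := row 2 (by omega)
  simp only [show ¬ (2 ≤ 1) by omega, if_false, if_true, Nat.add_one_sub_one] at h2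
  rw [h3] at h2
  simp only [ite_self, add_zero] at h2
  intro i hi
  by_cases h : 2 ≤ i
  · have := down (n - 1 - i) (by omega)
    rwa [show n - 1 - (n - 1 - i) = i by omega] at this
  · obtain rfl | rfl : i = 0 ∨ i = 1 := by omega
    all_goals omega

/-! ### Chebyshev polynomials of `A` applied to `e`. -/

/-- The value at the vertex `v` of the vector `C k (A) e`, for the adjacency matrix `A` of `D_n`
and `k ≤ n - 2`. -/
def chebWalk (n k v : ℕ) : ℤ :=
  (if v ≤ 1 then 1 else 0) + (if max v 1 = k + 1 then 1 else 0) + (if v + k = n then 1 else 0) +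
    if 2 ≤ v ∧ v + k < n then 2 else 0

theorem aeval_chebC_add_two_mulVec {n : ℕ} (A : Matrix (Fin n) (Fin n) ℤ) (e : Fin n → ℤ) (k : ℕ) :
    Matrix.mulVec (aeval A (chebC (k + 2))) e =
      Matrix.mulVec A (Matrix.mulVec (aeval A (chebC (k + 1))) e) -
        Matrix.mulVec (aeval A (chebC k)) e := by
  rw [chebC_add_two, map_sub, map_mul, aeval_X, Matrix.sub_mulVec, Matrix.mulVec_mulVec]

theorem aeval_chebC_mulVec_one {n : ℕ} (hn : 4 ≤ n) (k : ℕ) (hk : k + 2 ≤ n) :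
    Matrix.mulVec (aeval ((dynkinD n).adjMatrix ℤ) (chebC k)) (fun _ => 1) =
      fun v => chebWalk n k v.val := by
  induction k using Nat.twoStepInduction with
  | zero =>
    ext v
    have := v.isLt
    rw [chebC_zero, map_ofNat, Matrix.ofNat_mulVec]
    simp only [chebWalk, Pi.smul_apply, smul_eq_mul]
    split_ifs <;> omega
  | one =>
    ext v
    have := v.isLt
    rw [chebC_one, aeval_X, dynkinD_adjMatrix_mulVec hn (fun _ => 1)]
    simp only [chebWalk]
    split_ifs <;> omega
  | more k h0 h1 =>
    rw [aeval_chebC_add_two_mulVec, h0 (by omega), h1 (by omega)]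
    ext v
    have := v.isLt
    rw [Pi.sub_apply, dynkinD_adjMatrix_mulVec hn]
    simp only [chebWalk]
    grind (splits := 30)

/-- Conceptually, `C (n - 1)` is the characteristic polynomial of `A` on the vectors symmetric in
the two short leaves, and `e` is one of them. -/
theorem aeval_chebC_pred_mulVec_one {n : ℕ} (hn : 4 ≤ n) :
    Matrix.mulVec (aeval ((dynkinD n).adjMatrix ℤ) (chebC (n - 1))) (fun _ => 1) = 0 := by
  rw [show n - 1 = (n - 3) + 2 by omega, aeval_chebC_add_two_mulVec,
    aeval_chebC_mulVec_one hn _ (by omega), aeval_chebC_mulVec_one hn _ (by omega)]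
  ext v
  have := v.isLt
  rw [Pi.sub_apply, dynkinD_adjMatrix_mulVec hn]
  simp only [chebWalk, Pi.zero_apply]
  grind (splits := 30)

/-- The value at the vertex `v` of the vector `altChebC r (A) e`. -/
def altChebWalk (n : ℕ) : ℕ → ℕ → ℤ
  | 0, _ => 1
  | r + 1, v => chebWalk n (2 * r + 2) v - altChebWalk n r v

theorem aeval_altChebC_mulVec_one {n : ℕ} (hn : 4 ≤ n) (r : ℕ) (hr : 2 * r + 2 ≤ n) :
    Matrix.mulVec (aeval ((dynkinD n).adjMatrix ℤ) (altChebC r)) (fun _ => 1) =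
      fun v => altChebWalk n r v.val := by
  induction r with
  | zero => simp [altChebC, altChebWalk]
  | succ r ih =>
    rw [altChebC, map_sub, Matrix.sub_mulVec, ih (by omega), aeval_chebC_mulVec_one hn _ (by omega)]
    rfl

theorem altChebWalk_zero_eq_one (n r : ℕ) (hr : 2 * r + 2 ≤ n) :
    altChebWalk n r 0 = altChebWalk n r 1 := by
  induction r with
  | zero => rfl
  | succ r ih =>
    rw [altChebWalk, altChebWalk, ih (by omega)]
    simp only [chebWalk]
    split_ifs <;> omega

theorem altChebWalk_last (n r : ℕ) (hn : 4 ≤ n) (hr : 2 * r + 2 < n) :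
    altChebWalk n r (n - 1) = (-1) ^ r := by
  induction r with
  | zero => rfl
  | succ r ih =>
    have : chebWalk n (2 * r + 2) (n - 1) = 0 := by
      simp only [chebWalk]
      split_ifs <;> omega
    rw [altChebWalk, ih (by omega), this, pow_succ]
    ring

theorem aeval_altChebC_mulVec_one_eq_zero {h : ℕ} (hh : Odd h) :
    Matrix.mulVec (aeval ((dynkinD (2 * h + 2)).adjMatrix ℤ) (altChebC h)) (fun _ => 1) = 0 := by
  have hpos := hh.pos
  have hn : 4 ≤ 2 * h + 2 := by omega
  have hv := aeval_altChebC_mulVec_one hn h le_rfl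
  rw [hv]
  have hker : Matrix.mulVec ((dynkinD (2 * h + 2)).adjMatrix ℤ)
      (fun v => altChebWalk (2 * h + 2) h v.val) = 0 := by
    rw [← hv, Matrix.mulVec_mulVec]
    have := aeval_chebC_pred_mulVec_one hn
    rwa [show 2 * h + 2 - 1 = 2 * h + 1 by omega, ← X_mul_altChebC, map_mul, aeval_X] at this
  have hlast : altChebWalk (2 * h + 2) h (2 * h + 2 - 1) = 0 := by
    obtain ⟨r, rfl⟩ : ∃ r, h = r + 1 := ⟨h - 1, by omega⟩
    have hr : Even r := by
      rw [Nat.odd_add_one, Nat.not_odd_iff_even] at hh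
      exact hh
    -- At the far end `C (2 h)` contributes `1` and the earlier terms `(-1) ^ (h - 1)`; they cancel
    -- exactly because `h` is odd.
    rw [altChebWalk, altChebWalk_last _ _ hn (by omega), hr.neg_one_pow]
    simp only [chebWalk]
    split_ifs <;> omega
  ext v
  exact eq_zero_of_dynkinD_adjMatrix_mulVec_eq_zero hn _ hker
    (altChebWalk_zero_eq_one _ _ le_rfl) hlast v.val v.isLt

/-! ### The two adapted bases. -/

/-- A basis of the polynomials of degree less than `2 h + 2` that is adapted to the walk matrix
of `D_(2 h + 2)`. -/
noncomputable def sourcePoly (h i : ℕ) : ℤ[X] :=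
  if i < h then chebC (2 * h - i)
  else if i < 2 * h then chebC (i - h + 1) - chebC (3 * h - i)
  else if i = 2 * h then altChebC h
  else chebC (2 * h + 1)

/-- A basis of `ℤ ^ (2 h + 2)` that is adapted to the walk matrix of `D_(2 h + 2)`. -/
def targetVec (h i v : ℕ) : ℤ :=
  if i < h then chebWalk (2 * h + 2) (2 * h - i) v
  else if i < 2 * h then (if i - h + 2 ≤ v ∧ v ≤ 3 * h - i then 1 else 0)
  else if i = 2 * h then (if v ≤ 1 then 1 else 0)
  else (if v = 0 then 1 else 0)

theorem natDegree_sourcePoly_lt (h i : ℕ) (hi : i < 2 * h + 2) :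
    (sourcePoly h i).natDegree < 2 * h + 2 := by
  unfold sourcePoly
  split_ifs
  · have := natDegree_chebC_le (2 * h - i)
    omega
  · have h1 := natDegree_chebC_le (i - h + 1)
    have h2 := natDegree_chebC_le (3 * h - i)
    have := natDegree_sub_le (chebC (i - h + 1)) (chebC (3 * h - i))
    omega
  · have := natDegree_altChebC_le h
    omega
  · have := natDegree_chebC_le (2 * h + 1)
    omega

theorem aeval_sourcePoly_mulVec_one {h : ℕ} (hh : Odd h) (i : ℕ) (hi : i < 2 * h + 2) :
    Matrix.mulVec (aeval ((dynkinD (2 * h + 2)).adjMatrix ℤ) (sourcePoly h i)) (fun _ => 1) =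
      fun v => targetVec h i v.val * if i < h then 1 else if i < 2 * h then 2 else 0 := by
  have hpos := hh.pos
  have hn : 4 ≤ 2 * h + 2 := by omega
  by_cases h1 : i < h
  · simp only [sourcePoly, targetVec, if_pos h1, mul_one]
    exact aeval_chebC_mulVec_one hn _ (by omega)
  by_cases h2 : i < 2 * h
  · simp only [sourcePoly, targetVec, if_neg h1, if_pos h2]
    rw [map_sub, Matrix.sub_mulVec, aeval_chebC_mulVec_one hn _ (by omega),
      aeval_chebC_mulVec_one hn _ (by omega)]
    ext v
    have := v.isLt
    simp only [chebWalk, Pi.sub_apply]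
    split_ifs <;> omega
  simp only [sourcePoly, if_neg h1, if_neg h2, mul_zero]
  split_ifs
  · exact aeval_altChebC_mulVec_one_eq_zero hh
  · exact aeval_chebC_pred_mulVec_one hn

/-- Every power of `X` up to `X ^ m` is generated by `1, C 1, …, C m`. -/
theorem X_pow_mem_of_chebC_mem (N : Submodule ℤ ℤ[X]) (m : ℕ) (h0 : (1 : ℤ[X]) ∈ N)
    (hN : ∀ k, 1 ≤ k → k ≤ m → chebC k ∈ N) : X ^ m ∈ N := by
  have key : ∀ j, X ^ j ∈ Submodule.span ℤ (insert 1 (chebC '' Set.Icc 1 j)) := by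
    intro j
    induction j with
    | zero => exact Submodule.subset_span (by simp)
    | succ j ih =>
      set T := Submodule.span ℤ (insert 1 (chebC '' Set.Icc 1 (j + 1)))
      have hone : (1 : ℤ[X]) ∈ T := Submodule.subset_span (by simp)
      have hc : ∀ k, 1 ≤ k → k ≤ j + 1 → chebC k ∈ T := fun k h1 h2 =>
        Submodule.subset_span (Set.mem_insert_of_mem _ ⟨k, ⟨h1, h2⟩, rfl⟩)
      have hle : Submodule.span ℤ (insert 1 (chebC '' Set.Icc 1 j)) ≤
          T.comap (LinearMap.mulLeft ℤ X) := by
        rw [Submodule.span_le]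
        rintro p (rfl | ⟨k, ⟨h1, h2⟩, rfl⟩)
        · simpa [← chebC_one] using hc 1 le_rfl (by omega)
        · obtain ⟨k, rfl⟩ : ∃ l, k = l + 1 := ⟨k - 1, by omega⟩
          have hX : X * chebC (k + 1) = chebC (k + 2) + chebC k := by
            rw [chebC_add_two]; ring
          simp only [Submodule.comap_coe, Set.mem_preimage, LinearMap.mulLeft_apply,
            SetLike.mem_coe]
          rw [hX]
          refine T.add_mem (hc _ (by omega) (by omega)) ?_
          rcases Nat.eq_zero_or_pos k with rfl | hk
          · rw [chebC_zero, ← one_add_one_eq_two]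
            exact T.add_mem hone hone
          · exact hc k hk (by omega)
      have := hle ih
      rwa [Submodule.mem_comap, LinearMap.mulLeft_apply, ← pow_succ'] at this
  refine (Submodule.span_le.2 ?_) (key m)
  rintro p (rfl | ⟨k, ⟨h1, h2⟩, rfl⟩)
  · exact h0
  · exact hN k h1 h2

theorem isUnit_det_sourcePoly (h : ℕ) :
    IsUnit (Matrix.of fun i k : Fin (2 * h + 2) =>
      coeffVec (2 * h + 2) (sourcePoly h k.val) i).det := by
  refine isUnit_det_of_span (fun k => coeffVec (2 * h + 2) (sourcePoly h k.val)) fun i => ?_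
  set N := Submodule.span ℤ (Set.range fun k : Fin (2 * h + 2) => sourcePoly h k.val) with hN
  have hmap : Submodule.span ℤ
      (Set.range fun k : Fin (2 * h + 2) => coeffVec (2 * h + 2) (sourcePoly h k.val)) =
      N.map (coeffVec (2 * h + 2)) := by
    rw [hN, Submodule.map_span, ← Set.range_comp]
    rfl
  rw [hmap, ← coeffVec_X_pow]
  refine Submodule.mem_map_of_mem ?_
  have hs : ∀ k < 2 * h + 2, sourcePoly h k ∈ N := fun k hk =>
    Submodule.subset_span ⟨⟨k, hk⟩, rfl⟩
  have hhigh : ∀ k, h < k → k ≤ 2 * h → chebC k ∈ N := by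
    intro k h1 h2
    have := hs (2 * h - k) (by omega)
    rwa [sourcePoly, if_pos (by omega), show 2 * h - (2 * h - k) = k by omega] at this
  have hall : ∀ k, 1 ≤ k → k ≤ 2 * h + 1 → chebC k ∈ N := by
    intro k h1 h2
    rcases lt_or_ge h k with h3 | h3
    · rcases Nat.lt_or_ge (2 * h) k with h4 | h4
      · obtain rfl : k = 2 * h + 1 := by omega
        have := hs (2 * h + 1) (by omega)
        rwa [sourcePoly, if_neg (by omega), if_neg (by omega), if_neg (by omega)] at this
      · exact hhigh k h3 h4
    · have := hs (k + h - 1) (by omega)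
      rw [sourcePoly, if_neg (by omega), if_pos (by omega),
        show k + h - 1 - h + 1 = k by omega] at this
      simpa using N.add_mem this (hhigh (3 * h - (k + h - 1)) (by omega) (by omega))
  have hone : (1 : ℤ[X]) ∈ N := by
    -- As `C 0 = 2`, the `C k` alone do not generate the constant `1`; it is what remains of
    -- `altChebC h` once its other terms are removed.
    have halt : ∀ r ≤ h, altChebC r ∈ N → (1 : ℤ[X]) ∈ N := by
      intro r
      induction r with
      | zero => exact fun _ hr => hr
      | succ r ih =>
        intro hr hmem
        refine ih (by omega) ?_
        have := N.sub_mem (hall (2 * r + 2) (by omega) (by omega)) hmem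
        rwa [altChebC, sub_sub_cancel] at this
    refine halt h le_rfl ?_
    have := hs (2 * h) (by omega)
    rwa [sourcePoly, if_neg (by omega), if_neg (by omega), if_pos rfl] at this
  exact X_pow_mem_of_chebC_mem N i.val hone fun k h1 h2 => hall k h1 (by omega)

theorem isUnit_det_targetVec {h : ℕ} (hh : Odd h) :
    IsUnit (Matrix.of fun i k : Fin (2 * h + 2) => targetVec h k.val i.val).det := by
  have hpos := hh.pos
  refine isUnit_det_of_span (fun k v : Fin (2 * h + 2) => targetVec h k.val v.val) ?_
  set N := Submodule.span ℤ
    (Set.range fun k v : Fin (2 * h + 2) => targetVec h k.val v.val)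
  have ht : ∀ k < 2 * h + 2, (fun v : Fin (2 * h + 2) => targetVec h k v.val) ∈ N := fun k hk =>
    Submodule.subset_span ⟨⟨k, hk⟩, rfl⟩
  -- indicator vectors of a vertex, of an initial piece and of a middle piece of the long arm
  let f : ℕ → Fin (2 * h + 2) → ℤ := fun a v => if v.val = a then 1 else 0
  let s : ℕ → Fin (2 * h + 2) → ℤ := fun k v => if 2 ≤ v.val ∧ v.val ≤ k + 1 then 1 else 0
  let u : ℕ → Fin (2 * h + 2) → ℤ := fun k v => if k < v.val ∧ v.val ≤ 2 * h + 1 - k then 1 else 0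
  have hf0 : f 0 ∈ N := by
    have := ht (2 * h + 1) (by omega)
    simpa only [targetVec, if_neg (show ¬ 2 * h + 1 < h by omega),
      if_neg (show ¬ 2 * h + 1 < 2 * h by omega), if_neg (show ¬ 2 * h + 1 = 2 * h by omega)]
      using this
  have hleaves : f 0 + f 1 ∈ N := by
    convert ht (2 * h) (by omega) using 1
    ext v
    simp only [targetVec, f, Pi.add_apply]
    grind
  have hu : ∀ k, 1 ≤ k → k ≤ h + 1 → u k ∈ N := by
    intro k h1 h2
    rcases Nat.lt_or_ge h k with h3 | h3
    · convert N.zero_mem using 1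
      ext v
      simp only [u, Pi.zero_apply]
      grind
    · convert ht (k + h - 1) (by omega) using 1
      ext v
      simp only [targetVec, u]
      grind
  have hw : ∀ k, 1 ≤ k → k ≤ h → f (k + 1) + f (2 * h + 2 - k) + (2 : ℤ) • s (k - 1) ∈ N := by
    intro k h1 h2
    convert N.sub_mem (ht (k - 1) (by omega)) hleaves using 1
    ext v
    have := v.isLt
    simp only [targetVec, chebWalk, f, s, Pi.add_apply, Pi.sub_apply, Pi.smul_apply, smul_eq_mul]
    grind
  -- The difference `u (k + 1) - u (k + 2)` is `f (k + 2) + f (2 * h - k)`; it removes the far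
  -- vertex from the vector of `hw (k + 2)`.
  have hstep : ∀ k, k + 2 ≤ h → s (k + 2) + s k ∈ N := by
    intro k hk
    convert N.sub_mem (hw (k + 2) (by omega) hk)
      (N.sub_mem (hu (k + 1) (by omega) (by omega)) (hu (k + 2) (by omega) (by omega))) using 1
    ext v
    have := v.isLt
    simp only [f, s, u, Pi.add_apply, Pi.sub_apply, Pi.smul_apply, smul_eq_mul]
    grind
  have heven : ∀ r, 2 * r ≤ h → s (2 * r) ∈ N := by
    intro r
    induction r with
    | zero =>
      intro _
      convert N.zero_mem using 1
      ext v
      simp only [s, Pi.zero_apply]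
      grind
    | succ r ih =>
      intro hr
      simpa [mul_add] using N.sub_mem (hstep (2 * r) (by omega)) (ih (by omega))
  obtain ⟨q, rfl⟩ := hh
  -- Odd indices have no zero to start from: `u h` is the single vertex `h + 1`, so it turns `s (h -
  -- 1)` into `s h`, and `hstep` then descends.
  have hodd : ∀ r ≤ q, s (2 * (q - r) + 1) ∈ N := by
    intro r
    induction r with
    | zero =>
      intro _
      convert N.add_mem (heven q (by omega)) (hu (2 * q + 1) (by omega) (by omega)) using 1
      ext v
      simp only [s, u, Pi.add_apply]
      grind
    | succ r ih =>
      intro hr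
      have := N.sub_mem (hstep (2 * (q - (r + 1)) + 1) (by omega)) (by
        have := ih (by omega)
        rwa [show 2 * (q - r) + 1 = 2 * (q - (r + 1)) + 1 + 2 by omega] at this)
      simpa using this
  have hs : ∀ k ≤ 2 * q + 1, s k ∈ N := by
    intro k hk
    rcases Nat.even_or_odd' k with ⟨r, rfl | rfl⟩
    · exact heven r hk
    · have := hodd (q - r) (by omega)
      rwa [show q - (q - r) = r by omega] at this
  have hlow : ∀ k, 1 ≤ k → k ≤ 2 * q + 1 → f (k + 1) ∈ N := by
    intro k h1 h2
    convert N.sub_mem (hs k h2) (hs (k - 1) (by omega)) using 1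
    ext v
    simp only [f, s, Pi.sub_apply]
    grind
  intro i
  have hi := i.isLt
  suffices hfi : f i.val ∈ N by
    convert hfi using 1
    ext v
    simp [f, Pi.single_apply, Fin.ext_iff]
  by_cases h0 : i.val = 0
  · rwa [h0]
  by_cases h1 : i.val = 1
  · rw [h1]
    simpa using N.sub_mem hleaves hf0
  by_cases h2 : i.val ≤ 2 * q + 2
  · have := hlow (i.val - 1) (by omega) (by omega)
    rwa [show i.val - 1 + 1 = i.val by omega] at this
  · have h3 := hw (2 * (2 * q + 1) + 2 - i.val) (by omega) (by omega)
    have h4 := N.sub_mem (N.sub_mem h3 (N.smul_mem (2 : ℤ)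
      (hs (2 * (2 * q + 1) + 2 - i.val - 1) (by omega))))
      (hlow (2 * (2 * q + 1) + 2 - i.val) (by omega) (by omega))
    rw [show 2 * (2 * q + 1) + 2 - (2 * (2 * q + 1) + 2 - i.val) = i.val by omega] at h4
    simpa using h4

/-! ### Assembling the Smith normal form. -/

/-- If the columns of `M Q` are the multiples `d i` of the columns of `B`, with `B` and `Q`
unimodular, then `diag d` is equivalent to `M`. -/
theorem exists_unimodular_of_mul_eq {n : ℕ} {M Q B D : Matrix (Fin n) (Fin n) ℤ}
    (hQ : IsUnit Q.det) (hB : IsUnit B.det) (h : M * Q = B * D) :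
    ∃ P Q : Matrix (Fin n) (Fin n) ℤ, IsUnit P.det ∧ IsUnit Q.det ∧ P * M * Q = D :=
  ⟨B⁻¹, Q, Matrix.isUnit_nonsing_inv_det B hB, hQ, by
    rw [Matrix.mul_assoc, h, Matrix.nonsing_inv_mul_cancel_left B D hB]⟩

theorem isSmithNormalForm_walkMatrix_dynkinD {h : ℕ} (hh : Odd h) :
    IsSmithNormalForm (walkMatrix (dynkinD (2 * h + 2)))
      (Matrix.diagonal fun i : Fin (2 * h + 2) =>
        if i.val < h then (1 : ℤ) else if i.val < 2 * h then 2 else 0) := by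
  refine ⟨Matrix.isDiag_diagonal _, fun i => ?_, fun i j hij => ?_,
    exists_unimodular_of_mul_eq (isUnit_det_sourcePoly h) (isUnit_det_targetVec hh) ?_⟩
  · rw [Matrix.diagonal_apply_eq]
    split_ifs <;> norm_num
  · rw [Matrix.diagonal_apply_eq, Matrix.diagonal_apply_eq]
    split_ifs <;> first | omega | norm_num
  · ext v k
    have h1 := walkMatrix_mulVec_coeffVec (dynkinD (2 * h + 2))
      (natDegree_sourcePoly_lt h k.val k.isLt)
    rw [aeval_sourcePoly_mulVec_one hh k.val k.isLt] at h1
    rw [Matrix.mul_diagonal]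
    exact congrFun h1 v

/-- The diagonal is `1` (`n / 2 - 1` times), `2` (`n / 2 - 1` times), `0`, `0`. -/
theorem theorem1p2 (n : ℕ) (hpos : 0 < n) (hn : 4 ∣ n) :
    IsSmithNormalForm (walkMatrix (dynkinD n))
      (Matrix.diagonal fun i : Fin n =>
        if i.val < n / 2 - 1 then (1 : ℤ) else if i.val < n - 2 then 2 else 0) := by
  obtain ⟨h, hh, rfl⟩ : ∃ h, Odd h ∧ n = 2 * h + 2 :=
    ⟨n / 2 - 1, by rw [Nat.odd_iff]; omega, by omega⟩
  have := isSmithNormalForm_walkMatrix_dynkinD hh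
  rwa [show (2 * h + 2) / 2 - 1 = h by omega, show 2 * h + 2 - 2 = 2 * h by omega]
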